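/- Let $n,k,\ell,d,r$ be natural numbers with $0\le r\le n-1$, and let $A$ be an $\ell\times k$ matrix whose entries are homogeneous polynomials of the same degree $d$ in $\mathbb{C}[\partial_1,\dots,\partial_n]$. Polynomials act on distributions by $\partial_s=\partial/\partial x_s$, and a vector $\phi=(\phi_1,\dots,\phi_k)$ of distributions in $\mathcal{D}'(\mathbb{R}^n,\mathbb{C})$ is a solution to $A$ if $\sum_{j=1}^k a_{ij}(\partial)\,\phi_j=0$ for $i=1,\dots,\ell$. For $y\in\mathbb{R}^n$ let $A(y)\in\mathbb{C}^{\ell\times k}$ be the matrix obtained by substituting $y_s$ for $\partial_s$, and define the real wave cone $$\mathcal{W}^r_{A,\mathbb{R}}\;=\;\bigcup_{\pi\in\mathrm{Gr}_{\mathbb{R}}(n-r,n)}\ \bigcap_{y\in\pi\setminus\{0\}}\ker A(y)\;\subseteq\;\mathbb{C}^k ,$$ where $\mathrm{Gr}_{\mathbb{R}}(n-r,n)$ is the set of $(n-r)$-dimensional linear subspaces of $\mathbb{R}^n$. For a real $(n-r)\times n$ matrix $L$ of rank $n-r$ and a distribution $\delta\in\mathcal{D}'(\mathbb{R}^{n-r},\mathbb{C})$,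 let $\delta(Lx)$ be the distribution on $\mathbb{R}^n$ that maps a test function $f$ to $\delta(f_L)$, where $f_L$ is the test function $$f_L(y)=\frac{1}{\sqrt{\det(LL^T)}}\int_{\ker L} f\bigl(L^T(LL^T)^{-1}y+w\bigr)\,dw\qquad(y\in\mathbb{R}^{n-r})$$ and $dw$ is the Lebesgue measure of the Euclidean space $\ker L$; for a continuous function $\delta$ this is the ordinary composition $x\mapsto\delta(Lx)$. Then a vector $u\in\mathbb{C}^k$ lies in $\mathcal{W}^r_{A,\mathbb{R}}$ if and only if there is a matrix $L\in\mathbb{R}^{(n-r)\times n}$ of rank $n-r$ such that $x\mapsto\delta(Lx)\cdot u$ is a solution to $A$ for all distributions $\delta\in\mathcal{D}'(\mathbb{R}^{n-r},\mathbb{C})$. -/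

import Mathlib

open scoped Distributions ContDiff Matrix
open TopologicalSpace MeasureTheory

noncomputable section

namespace WaveCone

/-! ### Integration over the fibres of a linear map -/

section FiberIntegral

variable {E G N : Type} [NormedAddCommGroup E] [NormedSpace ℝ E]
  [NormedAddCommGroup G] [NormedSpace ℝ G] [NormedAddCommGroup N] [NormedSpace ℝ N]
  [MeasurableSpace N]

/-- `fiberIntegral s i μ f y = ∫ f (s y + i w) dμ(w)`. -/
def fiberIntegral {F : Type} [NormedAddCommGroup F] [NormedSpace ℝ F]
    (s : G →L[ℝ] E) (i : N →L[ℝ] E) (μ : Measure N) (f : E → F) (y : G) : F :=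
  ∫ w, f (s y + i w) ∂μ

variable [BorelSpace N] {s : G →L[ℝ] E} {i : N →L[ℝ] E}
  {μ : Measure N} [IsFiniteMeasureOnCompacts μ] {K : Set E} {k : Set N}

theorem fiberIntegral_integrable {F : Type} [NormedAddCommGroup F] [NormedSpace ℝ F]
    (hk : IsCompact k) (hKk : ∀ y w, s y + i w ∈ K → w ∈ k)
    {f : E → F} (hf : Continuous f) (hfK : tsupport f ⊆ K) (y : G) :
    Integrable (fun w => f (s y + i w)) μ := by
  have hc : Continuous fun w => f (s y + i w) := by fun_prop
  refine hc.integrable_of_hasCompactSupport (HasCompactSupport.intro hk ?_)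
  intro w hw
  by_contra h
  exact hw (hKk y w (hfK (subset_tsupport f h)))

variable [SecondCountableTopology N]

theorem fiberIntegral_hasFDerivAt {F : Type} [NormedAddCommGroup F] [NormedSpace ℝ F]
    (hK : IsCompact K) (hk : IsCompact k) (hKk : ∀ y w, s y + i w ∈ K → w ∈ k)
    {f : E → F} (hf : ContDiff ℝ 1 f) (hfK : tsupport f ⊆ K) (y : G) :
    HasFDerivAt (fiberIntegral s i μ f)
      (fiberIntegral s i μ (fun x => (fderiv ℝ f x).comp s) y) y := by
  have hd : Continuous (fderiv ℝ f) := hf.continuous_fderiv (by norm_num)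
  have hfs : HasCompactSupport f := hK.of_isClosed_subset (isClosed_tsupport f) hfK
  obtain ⟨C, hC⟩ := (hfs.fderiv (𝕜 := ℝ)).exists_bound_of_continuous hd
  have hz : ∀ x, x ∉ K → fderiv ℝ f x = 0 := fun x hx => by
    by_contra h
    exact hx (hfK (support_fderiv_subset ℝ h))
  refine hasFDerivAt_integral_of_dominated_of_fderiv_le (s := Set.univ)
    (F := fun y w => f (s y + i w)) (F' := fun y w => (fderiv ℝ f (s y + i w)).comp s)
    (bound := k.indicator fun _ => C * ‖s‖) Filter.univ_mem ?_ ?_ ?_ ?_ ?_ ?_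
  · have := hf.continuous
    exact .of_forall fun y => Continuous.aestronglyMeasurable (by fun_prop)
  · exact fiberIntegral_integrable hk hKk hf.continuous hfK y
  · exact Continuous.aestronglyMeasurable (by fun_prop)
  · refine .of_forall fun w y _ => ?_
    by_cases hw : w ∈ k
    · rw [Set.indicator_of_mem hw]
      exact (ContinuousLinearMap.opNorm_comp_le _ _).trans
        (mul_le_mul_of_nonneg_right (hC _) (norm_nonneg _))
    · rw [Set.indicator_of_notMem hw, hz _ fun h => hw (hKk y w h)]
      simp
  · exact (integrable_indicator_iff hk.measurableSet).2
      (integrableOn_const hk.measure_lt_top.ne)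
  · refine .of_forall fun w y _ => ?_
    have h1 : HasFDerivAt f (fderiv ℝ f (s y + i w)) (s y + i w) :=
      (hf.differentiable (by norm_num)).differentiableAt.hasFDerivAt
    exact h1.comp y (s.hasFDerivAt.add_const _)

theorem tsupport_fderiv_comp_subset {F : Type} [NormedAddCommGroup F] [NormedSpace ℝ F]
    {f : E → F} (hfK : tsupport f ⊆ K) :
    tsupport (fun x => (fderiv ℝ f x).comp s) ⊆ K := by
  refine (closure_mono fun x hx => ?_).trans ((tsupport_fderiv_subset ℝ (f := f)).trans hfK)
  intro h
  exact hx (by simp [h])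

theorem fiberIntegral_contDiff (hK : IsCompact K) (hk : IsCompact k)
    (hKk : ∀ y w, s y + i w ∈ K → w ∈ k) (m : ℕ) :
    ∀ {F : Type} [NormedAddCommGroup F] [NormedSpace ℝ F] {f : E → F},
      ContDiff ℝ ∞ f → tsupport f ⊆ K → ContDiff ℝ m (fiberIntegral s i μ f) := by
  induction m with
  | zero =>
    intro F _ _ f hf hfK
    have hf1 : ContDiff ℝ 1 f := hf.of_le (by exact_mod_cast le_top)
    refine contDiff_zero.2 (continuous_iff_continuousAt.2 fun y => ?_)
    exact (fiberIntegral_hasFDerivAt hK hk hKk hf1 hfK y).continuousAt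
  | succ m ih =>
    intro F _ _ f hf hfK
    have hf1 : ContDiff ℝ 1 f := hf.of_le (by exact_mod_cast le_top)
    have hD := fiberIntegral_hasFDerivAt (μ := μ) hK hk hKk hf1 hfK
    have hfd : ContDiff ℝ ∞ (fun x => (fderiv ℝ f x).comp s) :=
      (contDiff_infty_iff_fderiv.1 hf).2.clm_comp contDiff_const
    push_cast
    refine contDiff_succ_iff_fderiv.2 ⟨fun y => (hD y).differentiableAt, by simp, ?_⟩
    rw [funext fun y => (hD y).fderiv]
    exact ih hfd (tsupport_fderiv_comp_subset hfK)

theorem fiberIntegral_norm_iteratedFDeriv_le (hK : IsCompact K) (hk : IsCompact k)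
    (hKk : ∀ y w, s y + i w ∈ K → w ∈ k) (m : ℕ) :
    ∀ {F : Type} [NormedAddCommGroup F] [NormedSpace ℝ F] {f : E → F},
      ContDiff ℝ ∞ f → tsupport f ⊆ K → ∀ C : ℝ, (∀ x, ‖iteratedFDeriv ℝ m f x‖ ≤ C) →
      ∀ y, ‖iteratedFDeriv ℝ m (fiberIntegral s i μ f) y‖ ≤ ‖s‖ ^ m * C * μ.real k := by
  induction m with
  | zero =>
    intro F _ _ f hf hfK C hC y
    have hz : ∀ w, w ∉ k → f (s y + i w) = 0 := fun w hw => by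
      by_contra h
      exact hw (hKk y w (hfK (subset_tsupport f h)))
    simp only [norm_iteratedFDeriv_zero] at hC ⊢
    rw [fiberIntegral, ← setIntegral_eq_integral_of_forall_compl_eq_zero hz, pow_zero, one_mul]
    exact norm_setIntegral_le_of_norm_le_const hk.measure_lt_top fun w _ => hC _
  | succ m ih =>
    intro F _ _ f hf hfK C hC y
    have hf1 : ContDiff ℝ 1 f := hf.of_le (by exact_mod_cast le_top)
    have hD := fiberIntegral_hasFDerivAt (μ := μ) hK hk hKk hf1 hfK
    have hf' : ContDiff ℝ ∞ (fderiv ℝ f) := (contDiff_infty_iff_fderiv.1 hf).2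
    have hfd : ContDiff ℝ ∞ (fun x => (fderiv ℝ f x).comp s) := hf'.clm_comp contDiff_const
    rw [← norm_iteratedFDeriv_fderiv, funext fun y => (hD y).fderiv]
    have := ih hfd (tsupport_fderiv_comp_subset hfK) (‖s‖ * C) (fun x => ?_) y
    · refine this.trans_eq (by ring)
    · let Λ : (E →L[ℝ] F) →L[ℝ] (G →L[ℝ] F) := (ContinuousLinearMap.compL ℝ G E F).flip s
      have hΛ : ‖Λ‖ ≤ ‖s‖ := by
        refine ContinuousLinearMap.opNorm_le_bound _ (norm_nonneg _) fun T => ?_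
        rw [mul_comm]
        exact ContinuousLinearMap.opNorm_comp_le T s
      have h1 := Λ.norm_iteratedFDeriv_comp_left (f := fderiv ℝ f) (x := x) (N := ∞) (n := m)
        hf'.contDiffAt (by exact_mod_cast le_top)
      rw [norm_iteratedFDeriv_fderiv] at h1
      exact h1.trans (mul_le_mul hΛ (hC x) (norm_nonneg _) (norm_nonneg _))

end FiberIntegral

/-! ### Composition of a distribution with a surjective linear map -/

/-- `ℝⁿ` with the Euclidean norm. -/
abbrev Rn (n : ℕ) : Type := EuclideanSpace ℝ (Fin n)

/-- The space `𝓓'(ℝⁿ, ℂ)` of complex-valued distributions on `ℝⁿ`. As always in Mathlib, they are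
continuous `ℝ`-linear maps to `ℂ` on real test functions; extension by `ℂ`-linearity to complex test
functions identifies them with the usual complex distributions. -/
abbrev Distr (n : ℕ) : Type := 𝓓'((⊤ : Opens (Rn n)), ℂ)

/-- Real test functions on `ℝⁿ`. -/
abbrev Test (n : ℕ) : Type := 𝓓((⊤ : Opens (Rn n)), ℝ)

section Pullback

variable {m n : ℕ}

/-- The linear map `x ↦ L x` from `ℝⁿ` to `ℝᵐ`. -/
def linMap (L : Matrix (Fin m) (Fin n) ℝ) : Rn n →L[ℝ] Rn m :=
  (Matrix.toEuclideanLin L).toContinuousLinearMap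

/-- The kernel of `L`, a Euclidean subspace of `ℝⁿ`. -/
abbrev kerOf (L : Matrix (Fin m) (Fin n) ℝ) : Submodule ℝ (Rn n) :=
  LinearMap.ker (Matrix.toEuclideanLin L)

/-- The right inverse `Lᵀ (L Lᵀ)⁻¹` of a matrix `L` of full row rank, as a linear map. -/
def rightInv (L : Matrix (Fin m) (Fin n) ℝ) : Rn m →L[ℝ] Rn n :=
  linMap (Lᵀ * (L * Lᵀ)⁻¹)

/-- For a test function `f` on `ℝⁿ`, the function
`y ↦ det (L Lᵀ) ^ (-1/2) * ∫_{w ∈ ker L} f (Lᵀ (L Lᵀ)⁻¹ y + w) dw` on `ℝᵐ`, where `dw` is the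
Lebesgue measure of the Euclidean space `ker L`. -/
def pushFun (L : Matrix (Fin m) (Fin n) ℝ) (f : Rn n → ℝ) (y : Rn m) : ℝ :=
  (√(L * Lᵀ).det)⁻¹ * fiberIntegral (rightInv L) (kerOf L).subtypeL volume f y

theorem linMap_rightInv {L : Matrix (Fin m) (Fin n) ℝ} (hL : L.rank = m) (y : Rn m) :
    linMap L (rightInv L y) = y := by
  have h1 : IsUnit (L * Lᵀ) := by
    rw [← Matrix.linearIndependent_rows_iff_isUnit, linearIndependent_iff_card_eq_finrank_span,
      Set.finrank, ← Matrix.rank_eq_finrank_span_row, Matrix.rank_self_mul_transpose, hL,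
      Fintype.card_fin]
  have h2 : L * (Lᵀ * (L * Lᵀ)⁻¹) = 1 := by
    rw [← Matrix.mul_assoc, Matrix.mul_nonsing_inv _ ((Matrix.isUnit_iff_isUnit_det _).1 h1)]
  ext j
  simp [rightInv, linMap, h2]

theorem linMap_ker {L : Matrix (Fin m) (Fin n) ℝ} (w : kerOf L) : linMap L w = 0 :=
  LinearMap.mem_ker.1 w.2

theorem exists_compact_fiber {L : Matrix (Fin m) (Fin n) ℝ} (hL : L.rank = m)
    {K : Set (Rn n)} (hK : IsCompact K) :
    ∃ k : Set (kerOf L), IsCompact k ∧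
      ∀ y w, rightInv L y + (kerOf L).subtypeL w ∈ K → w ∈ k := by
  let q : Rn n → Rn n := fun x => x - rightInv L (linMap L x)
  have hq : Continuous q := by fun_prop
  refine ⟨Subtype.val ⁻¹' (q '' K), ?_, fun y w h => ⟨_, h, ?_⟩⟩
  · exact (Submodule.closed_of_finiteDimensional (kerOf L)).isClosedEmbedding_subtypeVal
      |>.isCompact_preimage (hK.image hq)
  · simp only [q, Submodule.subtypeL_apply, map_add, linMap_rightInv hL, linMap_ker]
    simp

theorem pushFun_eqOn {L : Matrix (Fin m) (Fin n) ℝ} (hL : L.rank = m)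
    {K : Set (Rn n)} {f : Rn n → ℝ} (hf : tsupport f ⊆ K) :
    Set.EqOn (pushFun L f) 0 (linMap L '' K)ᶜ := by
  intro y hy
  have : ∀ w : kerOf L, f (rightInv L y + (kerOf L).subtypeL w) = 0 := fun w => by
    by_contra h
    refine hy ⟨_, hf (subset_tsupport f h), ?_⟩
    simp [linMap_rightInv hL, linMap_ker]
  simp only [pushFun, fiberIntegral, this, integral_zero, mul_zero, Pi.zero_apply]

theorem pushFun_contDiff {L : Matrix (Fin m) (Fin n) ℝ} (hL : L.rank = m)
    {f : Rn n → ℝ} (hf : ContDiff ℝ ∞ f) (hfs : HasCompactSupport f) :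
    ContDiff ℝ ∞ (pushFun L f) := by
  obtain ⟨k, hk, hKk⟩ := exists_compact_fiber hL hfs
  exact contDiff_const.mul (contDiff_infty.2 fun r => fiberIntegral_contDiff hfs hk hKk r hf le_rfl)

theorem pushFun_integrable {L : Matrix (Fin m) (Fin n) ℝ} (hL : L.rank = m)
    {f : Rn n → ℝ} (hf : Continuous f) (hfs : HasCompactSupport f) (y : Rn m) :
    Integrable (fun w : kerOf L => f (rightInv L y + (kerOf L).subtypeL w)) volume := by
  obtain ⟨k, hk, hKk⟩ := exists_compact_fiber hL hfs
  exact fiberIntegral_integrable hk hKk hf le_rfl y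

theorem pushFun_add {L : Matrix (Fin m) (Fin n) ℝ} (hL : L.rank = m)
    {f g : Rn n → ℝ} (hf : Continuous f) (hfs : HasCompactSupport f)
    (hg : Continuous g) (hgs : HasCompactSupport g) (y : Rn m) :
    pushFun L (fun x => f x + g x) y = pushFun L f y + pushFun L g y := by
  simp only [pushFun, fiberIntegral]
  rw [integral_add (pushFun_integrable hL hf hfs y) (pushFun_integrable hL hg hgs y), mul_add]

theorem pushFun_smul (L : Matrix (Fin m) (Fin n) ℝ) (c : ℝ) (f : Rn n → ℝ) (y : Rn m) :
    pushFun L (fun x => c * f x) y = c * pushFun L f y := by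
  simp only [pushFun, fiberIntegral]
  rw [integral_const_mul]
  ring

theorem pushFun_bound {L : Matrix (Fin m) (Fin n) ℝ} (hL : L.rank = m) (K : Compacts (Rn n))
    (r : ℕ) : ∃ C : ℝ, 0 ≤ C ∧ ∀ f : Rn n → ℝ, ContDiff ℝ ∞ f → tsupport f ⊆ K →
      ∀ M : ℝ, (∀ x, ‖iteratedFDeriv ℝ r f x‖ ≤ M) →
      ∀ y, ‖iteratedFDeriv ℝ r (pushFun L f) y‖ ≤ C * M := by
  obtain ⟨k, hk, hKk⟩ := exists_compact_fiber hL K.isCompact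
  refine ⟨(√(L * Lᵀ).det)⁻¹ * (‖rightInv L‖ ^ r * (volume : Measure (kerOf L)).real k),
    by positivity, fun f hf hfK M hM y => ?_⟩
  have h := fiberIntegral_norm_iteratedFDeriv_le (μ := (volume : Measure (kerOf L)))
    K.isCompact hk hKk r hf hfK M hM y
  have hc := fiberIntegral_contDiff (μ := (volume : Measure (kerOf L)))
    K.isCompact hk hKk r hf hfK
  have he : pushFun L f = (√(L * Lᵀ).det)⁻¹ •
      fiberIntegral (rightInv L) (kerOf L).subtypeL volume f := rfl
  rw [he, iteratedFDeriv_const_smul_apply hc.contDiffAt, norm_smul,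
    Real.norm_of_nonneg (by positivity), mul_assoc]
  exact mul_le_mul_of_nonneg_left (h.trans_eq (by ring)) (by positivity)

/-- `pushFun` between spaces of test functions with support in a fixed compact set. -/
def pushSupportedIn (L : Matrix (Fin m) (Fin n) ℝ) (hL : L.rank = m) (K : Compacts (Rn n)) :
    𝓓_{K}(Rn n, ℝ) →L[ℝ] 𝓓_{K.map (linMap L) (linMap L).continuous}(Rn m, ℝ) :=
  let Φ : 𝓓_{K}(Rn n, ℝ) →ₗ[ℝ] 𝓓_{K.map (linMap L) (linMap L).continuous}(Rn m, ℝ) :=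
    { toFun f := ⟨pushFun L f, pushFun_contDiff hL f.contDiff f.hasCompactSupport,
        pushFun_eqOn hL f.tsupport_subset⟩
      map_add' f g := by
        ext y
        exact pushFun_add hL f.continuous f.hasCompactSupport g.continuous g.hasCompactSupport y
      map_smul' c f := by
        ext y
        exact pushFun_smul L c f y }
  { toLinearMap := Φ
    cont := by
      refine WithSeminorms.continuous_of_isBounded (ContDiffMapSupportedIn.withSeminorms ℝ _ _ _ _)
        (ContDiffMapSupportedIn.withSeminorms ℝ _ _ _ _) Φ (.of_real fun r => ?_)
      obtain ⟨C, hC, h⟩ := pushFun_bound hL K r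
      refine ⟨{r}, C, fun f => ?_⟩
      rw [Finset.sup_singleton]
      exact ((Φ f).seminorm_top_le_iff ℝ (mul_nonneg hC (apply_nonneg _ _)) r).2 fun y _ =>
        h f f.contDiff f.tsupport_subset _
          (fun x => ContDiffMapSupportedIn.norm_iteratedFDeriv_apply_le_seminorm_top ℝ) y }

/-- The continuous linear map `f ↦ pushFun L f` from test functions on `ℝⁿ` to test functions
on `ℝᵐ`, for a matrix `L` of full row rank `m`. -/
def pushTest (L : Matrix (Fin m) (Fin n) ℝ) (hL : L.rank = m) : Test n →L[ℝ] Test m :=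
  TestFunction.limitCLM ℝ
    (fun f => ⟨pushFun L f, pushFun_contDiff hL f.contDiff f.hasCompactSupport,
      HasCompactSupport.intro (f.hasCompactSupport.isCompact.image (linMap L).continuous)
        (fun _ hy => pushFun_eqOn hL le_rfl hy), fun _ _ => trivial⟩)
    (fun K _ => (TestFunction.ofSupportedInCLM ℝ (Ω := ⊤) (fun _ _ => trivial)).comp
      (pushSupportedIn L hL K))
    (fun _ _ _ => by ext; rfl)

/-- The composition `x ↦ δ(L x)` of a distribution `δ` on `ℝᵐ` with a linear map `L : ℝⁿ → ℝᵐ` of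
rank `m`: the distribution `f ↦ δ (pushFun L f)` on `ℝⁿ`. -/
def pullback (L : Matrix (Fin m) (Fin n) ℝ) (hL : L.rank = m) (δ : Distr m) : Distr n :=
  (pushTest L hL).precompCompactConvergenceCLM ℂ δ

theorem pullback_apply (L : Matrix (Fin m) (Fin n) ℝ) (hL : L.rank = m) (δ : Distr m)
    (f : Test n) : pullback L hL δ f = δ (pushTest L hL f) := rfl

theorem pushTest_apply (L : Matrix (Fin m) (Fin n) ℝ) (hL : L.rank = m) (f : Test n) (y : Rn m) :
    pushTest L hL f y = pushFun L f y := rfl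

end Pullback

/-! ### Constant coefficient operators, their solutions and their wave cones -/

variable {n k l : ℕ}

/-- The partial derivative `∂ T / ∂ x_s` of a distribution. -/
def partialDeriv (s : Fin n) (T : Distr n) : Distr n :=
  Distribution.lineDerivCLM (EuclideanSpace.single s (1 : ℝ)) T

/-- The derivative `∂₁^{α₁} ⋯ ∂ₙ^{αₙ} T` of a distribution. -/
def multiDeriv (α : Fin n →₀ ℕ) (T : Distr n) : Distr n :=
  (List.finRange n).foldr (fun s S => (partialDeriv s)^[α s] S) T

/-- The action `p(∂) • T` of a polynomial `p ∈ ℂ[∂₁, …, ∂ₙ]` on a distribution. -/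
def polyAct (p : MvPolynomial (Fin n) ℂ) (T : Distr n) : Distr n :=
  ∑ α ∈ p.support, p.coeff α • multiDeriv α T

/-- The vector-valued distribution `φ : ℝⁿ → ℂᵏ` solves the system `A • φ = 0`. -/
def IsSolution (A : Matrix (Fin l) (Fin k) (MvPolynomial (Fin n) ℂ)) (φ : Fin k → Distr n) : Prop :=
  ∀ i, ∑ j, polyAct (A i j) (φ j) = 0

/-- The complex matrix `A(y)`, for `y ∈ ℝⁿ`. -/
def evalAt (A : Matrix (Fin l) (Fin k) (MvPolynomial (Fin n) ℂ)) (y : Rn n) :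
    Matrix (Fin l) (Fin k) ℂ :=
  A.map (MvPolynomial.eval fun s => (y s : ℂ))

/-- The level `r` real wave cone: the union, over all real subspaces `π ⊆ ℝⁿ` of dimension `n - r`,
of the intersections of the kernels of `A(y)` in `ℂᵏ` over all `y ∈ π \ {0}`. -/
def realWaveCone (A : Matrix (Fin l) (Fin k) (MvPolynomial (Fin n) ℂ)) (r : ℕ) :
    Set (Fin k → ℂ) :=
  ⋃ (π : Submodule ℝ (Rn n)) (_ : Module.finrank ℝ π = n - r),
    ⋂ (y : Rn n) (_ : y ∈ π ∧ y ≠ 0), {u | evalAt A y *ᵥ u = 0}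

end WaveCone

end

noncomputable section

namespace WaveCone

/-! ### The action of polynomials on distributions -/

section PolyAct

variable {n : ℕ}

/-! Put m = n - r. The core is the chain rule p(∂)(δ ∘ L) = (q(∂)δ) ∘ L with q(z) = p(Lᵀz)
(`polyAct_pullback`). Applied to the entries p of A u, it turns the system for δ(Lx) u into the
conditions (q(∂)δ) ∘ L = 0, one for each entry.

If A(y) u = 0 for all nonzero y in the row space of L, each q vanishes at every nonzero real point.
Since m > 0, this forces q = 0 as a polynomial (`eq_zero_of_eval_real_ne_zero`), so every δ gives a
solution. Conversely, δ = exp⟨z, ·⟩ satisfies q(∂)δ = q(z)δ, and its pullback is not zero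
(`pullback_expDistr_ne_zero`), so q(z) = 0, that is, A(Lᵀz) u = 0. The row spaces of the matrices L
of rank m are exactly the m-dimensional subspaces π (`exists_matrix_range_eq`), which gives the
union in the wave cone.

The chain rule is dual to a statement on test functions: integration over the fibres of L turns ∂_v
into ∂_{Lv} (`pushFun_fderiv_apply`). -/

theorem partialDeriv_apply (s : Fin n) (T : Distr n) (f : Test n) :
    partialDeriv s T f = - T (TestFunction.lineDerivCLM ℝ (EuclideanSpace.single s (1 : ℝ)) f) :=
  rfl

theorem partialDeriv_smul (s : Fin n) (c : ℂ) (T : Distr n) :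
    partialDeriv s (c • T) = c • partialDeriv s T := by
  ext f
  exact (smul_neg c _).symm

theorem lineDerivCLM_test_apply (v : Rn n) (f : Test n) (x : Rn n) :
    (TestFunction.lineDerivCLM ℝ v f : Test n) x = fderiv ℝ f x v := by
  rw [TestFunction.lineDerivCLM_apply_of_le (by simp)]
  exact ((f.contDiff.differentiable (by simp)) x).lineDeriv_eq_fderiv

theorem lineDerivCLM_comm (v w : Rn n) (f : Test n) :
    (TestFunction.lineDerivCLM ℝ v (TestFunction.lineDerivCLM ℝ w f : Test n) : Test n) =
      TestFunction.lineDerivCLM ℝ w (TestFunction.lineDerivCLM ℝ v f : Test n) := by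
  have hd : Differentiable ℝ (fderiv ℝ f) :=
    (contDiff_infty_iff_fderiv.1 f.contDiff).2.differentiable (by simp)
  have key (a b : Rn n) (x : Rn n) :
      (TestFunction.lineDerivCLM ℝ a (TestFunction.lineDerivCLM ℝ b f : Test n) : Test n) x =
        fderiv ℝ (fderiv ℝ f) x a b := by
    rw [lineDerivCLM_test_apply, funext (lineDerivCLM_test_apply b f),
      fderiv_clm_apply (hd x) (differentiableAt_const b)]
    simp
  ext x
  rw [key, key]
  have hs : ContDiffAt ℝ ∞ f x := f.contDiff.contDiffAt
  refine (hs.isSymmSndFDerivAt ?_).eq v w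
  rw [minSmoothness_of_isRCLikeNormedField]
  exact WithTop.coe_le_coe.2 (le_top : (2 : ℕ∞) ≤ ⊤)

theorem partialDeriv_comm (s t : Fin n) (T : Distr n) :
    partialDeriv s (partialDeriv t T) = partialDeriv t (partialDeriv s T) := by
  ext f
  simp only [partialDeriv_apply]
  rw [lineDerivCLM_comm]

theorem foldr_iterate_smul (α : Fin n → ℕ) (c : ℂ) (T : Distr n) (l : List (Fin n)) :
    l.foldr (fun s S => (partialDeriv s)^[α s] S) (c • T) =
      c • l.foldr (fun s S => (partialDeriv s)^[α s] S) T := by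
  induction l with
  | nil => rfl
  | cons s l ih =>
    have h : Function.Semiconj (fun S : Distr n => c • S) (partialDeriv s) (partialDeriv s) :=
      fun S => (partialDeriv_smul s c S).symm
    rw [List.foldr_cons, List.foldr_cons, ih]
    exact (h.iterate_right _ _).symm

theorem multiDeriv_smul (α : Fin n →₀ ℕ) (c : ℂ) (T : Distr n) :
    multiDeriv α (c • T) = c • multiDeriv α T :=
  foldr_iterate_smul α c T _

theorem multiDeriv_add (α : Fin n →₀ ℕ) (S T : Distr n) :
    multiDeriv α (S + T) = multiDeriv α S + multiDeriv α T := by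
  unfold multiDeriv
  induction List.finRange n with
  | nil => rfl
  | cons s l ih =>
    rw [List.foldr_cons, List.foldr_cons, List.foldr_cons, ih]
    exact iterate_map_add (Distribution.lineDerivCLM (EuclideanSpace.single s (1 : ℝ)) :
      Distr n →L[ℝ] Distr n) _ _ _

theorem foldr_iterate_partialDeriv (α : Fin n → ℕ) (t : Fin n) (T : Distr n)
    (l : List (Fin n)) :
    l.foldr (fun s S => (partialDeriv s)^[α s] S) (partialDeriv t T) =
      partialDeriv t (l.foldr (fun s S => (partialDeriv s)^[α s] S) T) := by
  induction l with
  | nil => rfl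
  | cons s l ih =>
    have h : Function.Commute (partialDeriv t) (partialDeriv s) := partialDeriv_comm t s
    rw [List.foldr_cons, List.foldr_cons, ih]
    exact (h.iterate_right _ _).symm

theorem foldr_iterate_congr {α β : Fin n → ℕ} (T : Distr n) (l : List (Fin n))
    (h : ∀ s ∈ l, α s = β s) :
    l.foldr (fun s S => (partialDeriv s)^[α s] S) T =
      l.foldr (fun s S => (partialDeriv s)^[β s] S) T := by
  induction l with
  | nil => rfl
  | cons s l ih =>
    rw [List.foldr_cons, List.foldr_cons, ih fun s hs => h s (List.mem_cons_of_mem _ hs),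
      h s List.mem_cons_self]

/-- Partial derivatives commute, so the additional ∂_t can be moved to the innermost place. -/
theorem multiDeriv_add_single (α : Fin n →₀ ℕ) (t : Fin n) (T : Distr n) :
    multiDeriv (α + Finsupp.single t 1) T = multiDeriv α (partialDeriv t T) := by
  unfold multiDeriv
  have ht := List.mem_finRange t
  have hn := List.nodup_finRange n
  -- The induction over the list needs t to occur in it exactly once, so that only one exponent
  -- changes.
  revert ht hn
  induction List.finRange n with
  | nil => simp
  | cons s l ih =>
    intro ht hn
    obtain ⟨hs, hn⟩ := List.nodup_cons.1 hn
    rw [List.foldr_cons, List.foldr_cons]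
    by_cases hst : s = t
    · subst hst
      rw [foldr_iterate_congr (β := α) T l, foldr_iterate_partialDeriv]
      · simp [Function.iterate_succ_apply]
      · intro r hr
        have : s ≠ r := fun h => hs (h ▸ hr)
        simp [this]
    · have h1 : t ∈ l := by
        rcases List.mem_cons.1 ht with h | h
        · exact absurd h.symm hst
        · exact h
      rw [ih h1 hn]
      simp [Ne.symm hst]

theorem multiDeriv_zero (T : Distr n) : multiDeriv 0 T = T := by
  unfold multiDeriv
  induction List.finRange n with
  | nil => rfl
  | cons s l ih => rw [List.foldr_cons, ih]; rfl

/-- Allows polynomials with different supports to be summed over a common index set. -/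
theorem polyAct_eq_sum {p : MvPolynomial (Fin n) ℂ} {S : Finset (Fin n →₀ ℕ)}
    (h : p.support ⊆ S) (T : Distr n) :
    polyAct p T = ∑ α ∈ S, p.coeff α • multiDeriv α T := by
  refine Finset.sum_subset h fun α _ hα => ?_
  rw [MvPolynomial.notMem_support_iff.1 hα]
  exact zero_smul ℂ (multiDeriv α T)

theorem polyAct_add (p q : MvPolynomial (Fin n) ℂ) (T : Distr n) :
    polyAct (p + q) T = polyAct p T + polyAct q T := by
  classical
  rw [polyAct_eq_sum MvPolynomial.support_add, polyAct_eq_sum Finset.subset_union_left,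
    polyAct_eq_sum (p := q) Finset.subset_union_right, ← Finset.sum_add_distrib]
  exact Finset.sum_congr rfl fun α _ => by
    rw [MvPolynomial.coeff_add]
    exact add_smul _ _ (multiDeriv α T)

theorem polyAct_zero (T : Distr n) : polyAct 0 T = 0 := by
  simp [polyAct]

theorem polyAct_sum {ι : Type*} (I : Finset ι) (p : ι → MvPolynomial (Fin n) ℂ) (T : Distr n) :
    polyAct (∑ i ∈ I, p i) T = ∑ i ∈ I, polyAct (p i) T :=
  map_sum (⟨⟨fun p => polyAct p T, polyAct_zero T⟩, fun p q => polyAct_add p q T⟩ :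
    MvPolynomial (Fin n) ℂ →+ Distr n) p I

theorem polyAct_C_mul (c : ℂ) (p : MvPolynomial (Fin n) ℂ) (T : Distr n) :
    polyAct (MvPolynomial.C c * p) T = c • polyAct p T := by
  have h : (MvPolynomial.C c * p).support ⊆ p.support := by
    intro α hα
    rw [MvPolynomial.mem_support_iff, MvPolynomial.coeff_C_mul] at hα
    exact MvPolynomial.mem_support_iff.2 (right_ne_zero_of_mul hα)
  rw [polyAct_eq_sum h, polyAct, Finset.smul_sum]
  exact Finset.sum_congr rfl fun α _ => by rw [MvPolynomial.coeff_C_mul, mul_smul]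

theorem polyAct_C (c : ℂ) (T : Distr n) : polyAct (MvPolynomial.C c) T = c • T := by
  classical
  have h : (MvPolynomial.C c : MvPolynomial (Fin n) ℂ).support ⊆ {0} :=
    MvPolynomial.support_monomial_subset
  rw [polyAct_eq_sum h, Finset.sum_singleton, multiDeriv_zero, MvPolynomial.coeff_zero_C]

/-- Together with `polyAct_C` and `polyAct_add`, this makes `MvPolynomial.induction_on` available
for statements about `polyAct`. -/
theorem polyAct_mul_X (p : MvPolynomial (Fin n) ℂ) (s : Fin n) (T : Distr n) :
    polyAct (p * MvPolynomial.X s) T = polyAct p (partialDeriv s T) := by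
  rw [polyAct, MvPolynomial.support_mul_X, Finset.sum_map, polyAct]
  refine Finset.sum_congr rfl fun α _ => ?_
  rw [addRightEmbedding_apply, MvPolynomial.coeff_mul_X, multiDeriv_add_single]

theorem polyAct_smul_right (p : MvPolynomial (Fin n) ℂ) (c : ℂ) (T : Distr n) :
    polyAct p (c • T) = c • polyAct p T := by
  rw [polyAct, polyAct, Finset.smul_sum]
  exact Finset.sum_congr rfl fun α _ => by rw [multiDeriv_smul, smul_comm]

theorem polyAct_add_right (p : MvPolynomial (Fin n) ℂ) (S T : Distr n) :
    polyAct p (S + T) = polyAct p S + polyAct p T := by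
  rw [polyAct, polyAct, polyAct, ← Finset.sum_add_distrib]
  exact Finset.sum_congr rfl fun α _ => by rw [multiDeriv_add, smul_add]

theorem polyAct_sum_right {ι : Type*} (p : MvPolynomial (Fin n) ℂ) (I : Finset ι)
    (T : ι → Distr n) : polyAct p (∑ i ∈ I, T i) = ∑ i ∈ I, polyAct p (T i) :=
  map_sum (AddMonoidHom.mk' (polyAct p) (polyAct_add_right p)) T I

/-- A joint eigenvector of the partial derivatives is an eigenvector of every `p(∂)`. -/
theorem polyAct_of_partialDeriv_eq_smul {T : Distr n} {w : Fin n → ℂ}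
    (h : ∀ s, partialDeriv s T = w s • T) (p : MvPolynomial (Fin n) ℂ) :
    polyAct p T = MvPolynomial.eval w p • T := by
  induction p using MvPolynomial.induction_on with
  | C c => rw [polyAct_C, MvPolynomial.eval_C]
  | add p q hp hq => 
    rw [polyAct_add, hp, hq, map_add]
    exact (add_smul _ _ T).symm
  | mul_X p s hp =>
    rw [polyAct_mul_X, h, polyAct_smul_right, hp, map_mul, MvPolynomial.eval_X, smul_smul,
      mul_comm]

end PolyAct

/-! ### Derivatives of fibre integrals and of pullbacks -/

section PullbackDeriv

variable {m n : ℕ}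

/-- Integration by parts against the constant function 1. -/
theorem integral_fderiv_apply_eq_zero {V : Type*} [NormedAddCommGroup V] [NormedSpace ℝ V]
    [FiniteDimensional ℝ V] [MeasurableSpace V] [BorelSpace V] (μ : Measure V)
    [μ.IsAddHaarMeasure] {g : V → ℝ} (hg : ContDiff ℝ 1 g) (hgs : HasCompactSupport g) (v : V) :
    ∫ x, fderiv ℝ g x v ∂μ = 0 := by
  have hd : Continuous fun x => fderiv ℝ g x v :=
    (hg.continuous_fderiv (by simp)).clm_apply continuous_const
  have hds : HasCompactSupport fun x => fderiv ℝ g x v := hgs.fderiv_apply (𝕜 := ℝ) v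
  have h := integral_mul_fderiv_eq_neg_fderiv_mul_of_integrable (𝕜 := ℝ) (μ := μ)
    (f := fun _ => (1 : ℝ)) (g := g) (v := v) (by simp)
    (by simpa using hd.integrable_of_hasCompactSupport hds)
    (by simpa using hg.continuous.integrable_of_hasCompactSupport hgs)
    (fun _ _ => differentiableAt_const _)
    (fun x _ => hg.differentiable (by simp) x)
  simpa using h

theorem hasCompactSupport_fiber {L : Matrix (Fin m) (Fin n) ℝ} (hL : L.rank = m)
    {f : Rn n → ℝ} (hfs : HasCompactSupport f) (y : Rn m) :
    HasCompactSupport fun w : kerOf L => f (rightInv L y + (kerOf L).subtypeL w) := by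
  obtain ⟨k, hk, hKk⟩ := exists_compact_fiber hL hfs
  refine HasCompactSupport.intro hk fun w hw => ?_
  by_contra h
  exact hw (hKk y w (subset_tsupport f h))

/-- A derivative along the fibre is the derivative of the compactly supported integrand, so it
integrates to zero. -/
theorem pushFun_fderiv_apply_ker {L : Matrix (Fin m) (Fin n) ℝ} (hL : L.rank = m)
    {f : Rn n → ℝ} (hf : ContDiff ℝ 1 f) (hfs : HasCompactSupport f) (v : kerOf L) (y : Rn m) :
    pushFun L (fun x => fderiv ℝ f x v) y = 0 := by
  have hg : ContDiff ℝ 1 fun w : kerOf L => f (rightInv L y + (kerOf L).subtypeL w) :=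
    hf.comp (contDiff_const.add (kerOf L).subtypeL.contDiff)
  have h := integral_fderiv_apply_eq_zero volume hg (hasCompactSupport_fiber hL hfs y) v
  have hd (w : kerOf L) :
      fderiv ℝ (fun w : kerOf L => f (rightInv L y + (kerOf L).subtypeL w)) w v =
        fderiv ℝ f (rightInv L y + (kerOf L).subtypeL w) v := by
    have h1 : HasFDerivAt f (fderiv ℝ f (rightInv L y + (kerOf L).subtypeL w))
      (rightInv L y + (kerOf L).subtypeL w) := (hf.differentiable (by simp) _).hasFDerivAt
    exact congr($((h1.comp w ((kerOf L).subtypeL.hasFDerivAt.const_add _)).fderiv) v)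
  rw [pushFun, fiberIntegral, ← integral_congr_ae (.of_forall hd), h, mul_zero]

/-- Differentiation under the integral sign: moving y by v translates the fibre by `rightInv L v`.
-/
theorem pushFun_fderiv_apply_rightInv {L : Matrix (Fin m) (Fin n) ℝ} (hL : L.rank = m)
    {f : Rn n → ℝ} (hf : ContDiff ℝ 1 f) (hfs : HasCompactSupport f) (v y : Rn m) :
    pushFun L (fun x => fderiv ℝ f x (rightInv L v)) y = fderiv ℝ (pushFun L f) y v := by
  obtain ⟨k, hk, hKk⟩ := exists_compact_fiber hL hfs
  have hD := fiberIntegral_hasFDerivAt (μ := (volume : Measure (kerOf L))) hfs hk hKk hf le_rfl y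
  have hi : Integrable (fun w : kerOf L =>
      (fderiv ℝ f (rightInv L y + (kerOf L).subtypeL w)).comp (rightInv L)) volume := by
    refine fiberIntegral_integrable (f := fun x => (fderiv ℝ f x).comp (rightInv L)) hk hKk ?_
      (tsupport_fderiv_comp_subset le_rfl) y
    exact (hf.continuous_fderiv (by simp)).clm_comp continuous_const
  have he : pushFun L f = fun y => (√(L * Lᵀ).det)⁻¹ *
      fiberIntegral (rightInv L) (kerOf L).subtypeL volume f y := rfl
  rw [he, (hD.const_mul _).fderiv, smul_apply, fiberIntegral,
    ContinuousLinearMap.integral_apply hi]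
  rfl

/-- Split v into `rightInv L (linMap L v)` and a vector of the kernel; only the first part
contributes. -/
theorem pushFun_fderiv_apply {L : Matrix (Fin m) (Fin n) ℝ} (hL : L.rank = m)
    {f : Rn n → ℝ} (hf : ContDiff ℝ 1 f) (hfs : HasCompactSupport f) (v : Rn n) (y : Rn m) :
    pushFun L (fun x => fderiv ℝ f x v) y = fderiv ℝ (pushFun L f) y (linMap L v) := by
  have hw : v - rightInv L (linMap L v) ∈ kerOf L := by
    change linMap L _ = 0
    rw [map_sub, linMap_rightInv hL, sub_self]
  have hd (a : Rn n) : Continuous fun x => fderiv ℝ f x a :=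
    (hf.continuous_fderiv (by simp)).clm_apply continuous_const
  have hs (a : Rn n) : HasCompactSupport fun x => fderiv ℝ f x a := hfs.fderiv_apply (𝕜 := ℝ) a
  have he : (fun x => fderiv ℝ f x v) = fun x => fderiv ℝ f x (rightInv L (linMap L v)) +
      fderiv ℝ f x (⟨_, hw⟩ : kerOf L) := by
    funext x
    rw [← map_add]
    simp
  rw [he, pushFun_add hL (hd _) (hs _) (hd _) (hs _), pushFun_fderiv_apply_ker hL hf hfs,
    pushFun_fderiv_apply_rightInv hL hf hfs, add_zero]

theorem pushTest_lineDerivCLM (L : Matrix (Fin m) (Fin n) ℝ) (hL : L.rank = m) (v : Rn n)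
    (f : Test n) :
    pushTest L hL (TestFunction.lineDerivCLM ℝ v f : Test n) =
      TestFunction.lineDerivCLM ℝ (linMap L v) (pushTest L hL f) := by
  ext y
  rw [pushTest_apply, lineDerivCLM_test_apply, funext (lineDerivCLM_test_apply v f)]
  exact pushFun_fderiv_apply hL (f.contDiff.of_le (by exact_mod_cast le_top))
    f.hasCompactSupport v y

theorem linMap_single (L : Matrix (Fin m) (Fin n) ℝ) (s : Fin n) :
    linMap L (EuclideanSpace.single s 1) = ∑ i, L i s • EuclideanSpace.single i (1 : ℝ) := by
  ext i
  simp [linMap, Matrix.toEuclideanLin, Finset.sum_apply, Pi.single_apply]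

/-- The first-order chain rule, obtained by duality from `pushTest_lineDerivCLM` with v = e_s, for
which L v is the s-th column of L. -/
theorem partialDeriv_pullback (L : Matrix (Fin m) (Fin n) ℝ) (hL : L.rank = m) (δ : Distr m)
    (s : Fin n) :
    partialDeriv s (pullback L hL δ) =
      ∑ i, (L i s : ℂ) • pullback L hL (partialDeriv i δ) := by
  ext f
  have h : (TestFunction.lineDerivCLM ℝ (∑ i, L i s • EuclideanSpace.single i (1 : ℝ))
      (pushTest L hL f) : Test m) = ∑ i, L i s •
      (TestFunction.lineDerivCLM ℝ (EuclideanSpace.single i (1 : ℝ)) (pushTest L hL f) : Test m) := by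
    ext y
    have hd : DifferentiableAt ℝ (pushTest L hL f) y :=
      (pushTest L hL f).contDiff.differentiable (by simp) y
    simp [hd.lineDeriv_eq_fderiv]
  rw [partialDeriv_apply, pullback_apply, pushTest_lineDerivCLM, linMap_single, h, map_sum]
  have h2 : (∑ i, (L i s : ℂ) • pullback L hL (partialDeriv i δ)) f =
      ∑ i, (L i s : ℂ) * pullback L hL (partialDeriv i δ) f := by
    simp
  rw [h2, ← Finset.sum_neg_distrib]
  refine Finset.sum_congr rfl fun i _ => ?_
  rw [pullback_apply, partialDeriv_apply, map_smul, Complex.real_smul, mul_neg]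

theorem pullback_smul (L : Matrix (Fin m) (Fin n) ℝ) (hL : L.rank = m) (c : ℂ) (δ : Distr m) :
    pullback L hL (c • δ) = c • pullback L hL δ := rfl

theorem pullback_add (L : Matrix (Fin m) (Fin n) ℝ) (hL : L.rank = m) (δ ε : Distr m) :
    pullback L hL (δ + ε) = pullback L hL δ + pullback L hL ε := rfl

theorem pullback_zero (L : Matrix (Fin m) (Fin n) ℝ) (hL : L.rank = m) :
    pullback L hL 0 = 0 := rfl

/-- The substitution `∂_s ↦ ∑ i, L i s ∂_i`, which sends `p(y)` to `p(Lᵀ y)`. -/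
def substTranspose (L : Matrix (Fin m) (Fin n) ℝ) :
    MvPolynomial (Fin n) ℂ →ₐ[ℂ] MvPolynomial (Fin m) ℂ :=
  MvPolynomial.aeval fun s => ∑ i, MvPolynomial.C (L i s : ℂ) * MvPolynomial.X i

theorem eval_substTranspose (L : Matrix (Fin m) (Fin n) ℝ) (p : MvPolynomial (Fin n) ℂ)
    (z : Fin m → ℂ) :
    MvPolynomial.eval z (substTranspose L p) =
      MvPolynomial.eval (fun s => ∑ i, (L i s : ℂ) * z i) p := by
  induction p using MvPolynomial.induction_on with
  | C c => simp [substTranspose]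
  | add p q hp hq => rw [map_add, map_add, map_add, hp, hq]
  | mul_X p s hp =>
    rw [map_mul, map_mul, map_mul, hp]
    simp [substTranspose]

theorem polyAct_pullback (L : Matrix (Fin m) (Fin n) ℝ) (hL : L.rank = m)
    (p : MvPolynomial (Fin n) ℂ) (δ : Distr m) :
    polyAct p (pullback L hL δ) = pullback L hL (polyAct (substTranspose L p) δ) := by
  -- The product case uses the induction hypothesis for the derivatives of δ, hence the
  -- generalization.
  induction p using MvPolynomial.induction_on generalizing δ with
  | C c =>
    rw [show substTranspose L (MvPolynomial.C c) = MvPolynomial.C c by simp [substTranspose],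
      polyAct_C, polyAct_C, pullback_smul]
  | add p q hp hq => rw [polyAct_add, hp, hq, map_add, polyAct_add, pullback_add]
  | mul_X p s hp =>
    have hX : substTranspose L (p * MvPolynomial.X s) =
        ∑ i, MvPolynomial.C (L i s : ℂ) * (substTranspose L p * MvPolynomial.X i) := by
      rw [map_mul, show substTranspose L (MvPolynomial.X s) =
        ∑ i, MvPolynomial.C (L i s : ℂ) * MvPolynomial.X i by simp [substTranspose],
        Finset.mul_sum]
      exact Finset.sum_congr rfl fun i _ => by ring
    rw [polyAct_mul_X, partialDeriv_pullback, polyAct_sum_right, hX, polyAct_sum]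
    have hsum (D : Fin m → Distr m) : pullback L hL (∑ i, D i) = ∑ i, pullback L hL (D i) :=
      map_sum (AddMonoidHom.mk' (pullback L hL) (pullback_add L hL)) D _
    rw [hsum]
    refine Finset.sum_congr rfl fun i _ => ?_
    rw [polyAct_smul_right, hp, polyAct_C_mul, polyAct_mul_X, pullback_smul]

end PullbackDeriv

/-! ### Exponential distributions -/

section Exponential

variable {m n : ℕ}

theorem fderiv_exp_inner (z x v : Rn m) :
    fderiv ℝ (fun x : Rn m => Real.exp (inner ℝ z x)) x v =
      inner ℝ z v * Real.exp (inner ℝ z x) := by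
  have h := ((innerSL ℝ z).hasFDerivAt (x := x)).exp
  have h2 : HasFDerivAt (fun x : Rn m => Real.exp (inner ℝ z x)) _ x := h
  rw [h2.fderiv]
  simp [mul_comm]

/-- The distribution given by the function `x ↦ exp ⟨z, x⟩`. -/
def expDistr (z : Rn m) : Distr m :=
  Complex.ofRealCLM.postcompCompactConvergenceCLM _
    (TestFunction.integralAgainstBilinCLM (ContinuousLinearMap.mul ℝ ℝ) volume
      (fun x : Rn m => Real.exp (inner ℝ z x)) : Test m →L[ℝ] ℝ)

theorem expDistr_apply (z : Rn m) (f : Test m) :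
    expDistr z f = ((∫ x, f x * Real.exp (inner ℝ z x) : ℝ) : ℂ) := by
  have hc : Continuous fun x : Rn m => Real.exp (inner ℝ z x) := by fun_prop
  exact congrArg Complex.ofReal (TestFunction.integralAgainstBilinCLM_eq_integral
    (B := ContinuousLinearMap.mul ℝ ℝ) (hc.locallyIntegrable.locallyIntegrableOn _) (f := f))

/-- Integration by parts; the growth of the exponential is harmless because test functions have
compact support. Real exponents suffice, since the wave cone only involves real y. -/
theorem partialDeriv_expDistr (z : Rn m) (i : Fin m) :
    partialDeriv i (expDistr z) = (z i : ℂ) • expDistr z := by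
  ext f
  have hc : Continuous fun x : Rn m => Real.exp (inner ℝ z x) := by fun_prop
  have hd : Differentiable ℝ fun x : Rn m => Real.exp (inner ℝ z x) := fun x =>
    (((innerSL ℝ z).hasFDerivAt (x := x)).exp).differentiableAt
  have hf : Continuous fun x => fderiv ℝ f x (EuclideanSpace.single i 1) :=
    (f.contDiff.continuous_fderiv (by simp)).clm_apply continuous_const
  have hfs : HasCompactSupport fun x => fderiv ℝ f x (EuclideanSpace.single i 1) :=
    f.hasCompactSupport.fderiv_apply (𝕜 := ℝ) _
  have h := integral_mul_fderiv_eq_neg_fderiv_mul_of_integrable (𝕜 := ℝ) (μ := volume)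
    (f := f) (g := fun x : Rn m => Real.exp (inner ℝ z x)) (v := EuclideanSpace.single i 1)
    ((hf.mul hc).integrable_of_hasCompactSupport hfs.mul_right)
    (by
      simp only [fderiv_exp_inner]
      exact (f.continuous.mul (continuous_const.mul hc)).integrable_of_hasCompactSupport
        f.hasCompactSupport.mul_right)
    ((f.continuous.mul hc).integrable_of_hasCompactSupport f.hasCompactSupport.mul_right)
    (fun x _ => f.contDiff.differentiable (by simp) x) (fun x _ => hd x)
  have hz : inner ℝ z (EuclideanSpace.single i (1 : ℝ)) = z i := by
    simp [EuclideanSpace.inner_single_right]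
  simp only [fderiv_exp_inner, hz, mul_left_comm _ (z i), integral_const_mul] at h
  have hr : ((z i : ℂ) • expDistr z) f = (z i : ℂ) * expDistr z f := rfl
  rw [partialDeriv_apply, hr, expDistr_apply, expDistr_apply]
  simp only [lineDerivCLM_test_apply]
  rw [← Complex.ofReal_mul, h, Complex.ofReal_neg]

theorem pushFun_nonneg (L : Matrix (Fin m) (Fin n) ℝ) {f : Rn n → ℝ} (hf : ∀ x, 0 ≤ f x)
    (y : Rn m) : 0 ≤ pushFun L f y :=
  mul_nonneg (by positivity) (integral_nonneg fun _ => hf _)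

/-- The Gram matrix of the rows is positive semidefinite, and invertible by full row rank. -/
theorem det_mul_transpose_pos {L : Matrix (Fin m) (Fin n) ℝ} (hL : L.rank = m) :
    0 < (L * Lᵀ).det := by
  have h0 : 0 ≤ (L * Lᵀ).det := by
    simpa using (Matrix.posSemidef_self_mul_conjTranspose L).det_nonneg
  refine h0.lt_of_ne' ?_
  have h1 : IsUnit (L * Lᵀ) := by
    rw [← Matrix.linearIndependent_rows_iff_isUnit, linearIndependent_iff_card_eq_finrank_span,
      Set.finrank, ← Matrix.rank_eq_finrank_span_row, Matrix.rank_self_mul_transpose, hL,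
      Fintype.card_fin]
  exact ((Matrix.isUnit_iff_isUnit_det _).1 h1).ne_zero

theorem pushFun_zero_pos {L : Matrix (Fin m) (Fin n) ℝ} (hL : L.rank = m) {f : Rn n → ℝ}
    (hc : Continuous f) (hfs : HasCompactSupport f) (hf : ∀ x, 0 ≤ f x) (h0 : f 0 ≠ 0) :
    0 < pushFun L f 0 := by
  refine mul_pos (inv_pos.2 (Real.sqrt_pos.2 (det_mul_transpose_pos hL))) ?_
  have hc' : Continuous fun w : kerOf L => f (rightInv L 0 + (kerOf L).subtypeL w) := by fun_prop
  exact hc'.integral_pos_of_hasCompactSupport_nonneg_nonzero (hasCompactSupport_fiber hL hfs 0)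
    (fun _ => hf _) (x := 0) (by simpa using h0)

/-- Test against a bump function at 0: its fibre integral is continuous, nonnegative and positive at
0, so pairing it with the positive exponential gives a positive number. -/
theorem pullback_expDistr_ne_zero (L : Matrix (Fin m) (Fin n) ℝ) (hL : L.rank = m) (z : Rn m) :
    pullback L hL (expDistr z) ≠ 0 := by
  let b : ContDiffBump (0 : Rn n) := default
  let f : Test n := ⟨b, b.contDiff, b.hasCompactSupport, fun _ _ => trivial⟩
  intro h
  have h1 : pullback L hL (expDistr z) f = 0 := by rw [h]; rfl
  rw [pullback_apply, expDistr_apply, Complex.ofReal_eq_zero] at h1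
  have hc : Continuous fun y : Rn m => pushTest L hL f y * Real.exp (inner ℝ z y) :=
    (pushTest L hL f).continuous.mul (by fun_prop)
  refine (hc.integral_pos_of_hasCompactSupport_nonneg_nonzero
    (pushTest L hL f).hasCompactSupport.mul_right (fun y => ?_) (x := 0) ?_).ne' h1
  · exact mul_nonneg (pushFun_nonneg L (fun _ => b.nonneg) y) (Real.exp_pos _).le
  · refine mul_ne_zero ?_ (Real.exp_pos _).ne'
    refine (pushFun_zero_pos hL b.continuous b.hasCompactSupport (fun _ => b.nonneg) ?_).ne'
    exact (b.pos_of_mem_ball (Metric.mem_ball_self b.rOut_pos)).ne'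

end Exponential

/-! ### Characterisation of the wave cone -/

section Main

variable {m n k l : ℕ}

/-- The `i`-th entry of the vector of polynomials `A u`. -/
def applyVec (A : Matrix (Fin l) (Fin k) (MvPolynomial (Fin n) ℂ)) (u : Fin k → ℂ) (i : Fin l) :
    MvPolynomial (Fin n) ℂ :=
  ∑ j, MvPolynomial.C (u j) * A i j

theorem eval_applyVec (A : Matrix (Fin l) (Fin k) (MvPolynomial (Fin n) ℂ)) (u : Fin k → ℂ)
    (i : Fin l) (y : Rn n) :
    MvPolynomial.eval (fun s => (y s : ℂ)) (applyVec A u i) = (evalAt A y *ᵥ u) i := by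
  simp [applyVec, evalAt, Matrix.mulVec, dotProduct, mul_comm]

/-- Moves u from the distribution into the operator, leaving scalar equations for T alone. -/
theorem isSolution_smul_iff (A : Matrix (Fin l) (Fin k) (MvPolynomial (Fin n) ℂ))
    (u : Fin k → ℂ) (T : Distr n) :
    IsSolution A (fun j => u j • T) ↔ ∀ i, polyAct (applyVec A u i) T = 0 := by
  refine forall_congr' fun i => ?_
  rw [applyVec, polyAct_sum]
  simp only [polyAct_C_mul, polyAct_smul_right]

/-- Multiplication by a variable covers the missing point 0, so the product vanishes on all of ℝᵐ
and is the zero polynomial. For m = 0 the hypothesis would be vacuous. -/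
theorem eq_zero_of_eval_real_ne_zero (hm : 0 < m) {q : MvPolynomial (Fin m) ℂ}
    (h : ∀ z : Rn m, z ≠ 0 → MvPolynomial.eval (fun i => (z i : ℂ)) q = 0) : q = 0 := by
  have hX : q * MvPolynomial.X ⟨0, hm⟩ = 0 := by
    refine MvPolynomial.funext_set (fun _ => Set.range ((↑) : ℝ → ℂ))
      (fun _ => Set.infinite_range_of_injective Complex.ofReal_injective) fun x hx => ?_
    choose z hz using fun i => hx i (Set.mem_univ i)
    obtain rfl : (fun i => (z i : ℂ)) = x := funext hz
    by_cases h0 : z ⟨0, hm⟩ = 0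
    · simp [h0]
    · have := h (WithLp.toLp 2 z) fun hz0 => h0 (by simpa using congr($hz0 ⟨0, hm⟩))
      simp only [map_mul, map_zero]
      exact mul_eq_zero_of_left this _
  exact (mul_eq_zero.1 hX).resolve_right (MvPolynomial.X_ne_zero _)

theorem linMap_transpose_apply (L : Matrix (Fin m) (Fin n) ℝ) (z : Rn m) (s : Fin n) :
    ((linMap Lᵀ z s : ℝ) : ℂ) = ∑ i, (L i s : ℂ) * (z i : ℂ) := by
  simp [linMap, Matrix.toEuclideanLin, Matrix.mulVec, dotProduct]

theorem linMap_transpose_injective {L : Matrix (Fin m) (Fin n) ℝ} (hL : L.rank = m) :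
    Function.Injective (linMap Lᵀ) := by
  have h : LinearIndependent ℝ L.row := by
    rw [linearIndependent_iff_card_eq_finrank_span, Set.finrank, ← Matrix.rank_eq_finrank_span_row,
      hL, Fintype.card_fin]
  have h2 := (Matrix.mulVec_injective_iff (M := Lᵀ)).2 h
  intro x y hxy
  have := congr(WithLp.ofLp $hxy)
  ext i
  exact congrFun (h2 this) i

/-- All `x ↦ δ(L x) u` are solutions iff `A(y) u = 0` for all nonzero `y` in the row space of `L`. -/
theorem isSolution_pullback_iff (hm : 0 < m)
    (A : Matrix (Fin l) (Fin k) (MvPolynomial (Fin n) ℂ)) (u : Fin k → ℂ)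
    (L : Matrix (Fin m) (Fin n) ℝ) (hL : L.rank = m) :
    (∀ δ : Distr m, IsSolution A (fun j => u j • pullback L hL δ)) ↔
      ∀ y ∈ LinearMap.range (linMap Lᵀ).toLinearMap, y ≠ 0 → evalAt A y *ᵥ u = 0 := by
  have he (z : Rn m) (i : Fin l) : (evalAt A (linMap Lᵀ z) *ᵥ u) i =
      MvPolynomial.eval (fun i => (z i : ℂ)) (substTranspose L (applyVec A u i)) := by
    rw [← eval_applyVec, eval_substTranspose]
    simp only [linMap_transpose_apply]
  simp only [isSolution_smul_iff, polyAct_pullback]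
  constructor
  -- The condition y ≠ 0 is dropped: the exponential argument also works for z = 0.
  · rintro h _ ⟨z, rfl⟩ -
    ext i
    have h1 := h (expDistr z) i
    rw [polyAct_of_partialDeriv_eq_smul (partialDeriv_expDistr z), pullback_smul] at h1
    exact (he z i).trans ((smul_eq_zero.1 h1).resolve_right (pullback_expDistr_ne_zero L hL z))
  · intro h δ i
    have h1 : substTranspose L (applyVec A u i) = 0 := by
      -- Full rank makes Lᵀ injective, so a nonzero z yields a nonzero vector of the row space,
      -- where `h` applies.
      refine eq_zero_of_eval_real_ne_zero hm fun z hz => ?_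
      have h0 : linMap Lᵀ z ≠ 0 := fun h0 =>
        hz (linMap_transpose_injective hL (h0.trans (map_zero _).symm))
      exact (he z i).symm.trans (congrFun (h _ ⟨z, rfl⟩ h0) i)
    rw [h1, polyAct_zero, pullback_zero]

/-- The rows of L are a basis of π. -/
theorem exists_matrix_range_eq (π : Submodule ℝ (Rn n)) (hπ : Module.finrank ℝ π = m) :
    ∃ L : Matrix (Fin m) (Fin n) ℝ, L.rank = m ∧
      LinearMap.range (linMap Lᵀ).toLinearMap = π := by
  let b := Module.finBasisOfFinrankEq ℝ π hπ
  let L : Matrix (Fin m) (Fin n) ℝ := Matrix.of fun i s => (b i : Rn n) s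
  have hL (z : Rn m) : linMap Lᵀ z = (∑ i, z i • b i : π) := by
    ext s
    simp [linMap, L, Matrix.toEuclideanLin, Matrix.mulVec, dotProduct, mul_comm]
  have hr : LinearMap.range (linMap Lᵀ).toLinearMap = π := by
    ext x
    constructor
    · rintro ⟨z, rfl⟩
      exact (hL z).symm ▸ Subtype.mem _
    · intro hx
      refine ⟨WithLp.toLp 2 (b.repr ⟨x, hx⟩), (hL _).trans ?_⟩
      exact congrArg Subtype.val (b.sum_repr ⟨x, hx⟩)
  refine ⟨L, ?_, hr⟩
  rw [← Matrix.rank_transpose, Matrix.rank_eq_finrank_range_toLin Lᵀ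
    (EuclideanSpace.basisFun _ ℝ).toBasis (EuclideanSpace.basisFun _ ℝ).toBasis]
  exact (congrArg (fun V : Submodule ℝ (Rn n) => Module.finrank ℝ V) hr).trans hπ

end Main

end WaveCone

end

theorem mainTheorem5 (n k l d r : ℕ) (hr : r < n)
    (A : Matrix (Fin l) (Fin k) (MvPolynomial (Fin n) ℂ))
    (hA : ∀ i j, (A i j).IsHomogeneous d) (u : Fin k → ℂ) :
    u ∈ WaveCone.realWaveCone A r ↔
      ∃ (L : Matrix (Fin (n - r)) (Fin n) ℝ) (hL : L.rank = n - r),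
        ∀ δ : WaveCone.Distr (n - r),
          WaveCone.IsSolution A (fun j => u j • WaveCone.pullback L hL δ) := by
  have hm : 0 < n - r := Nat.sub_pos_of_lt hr
  simp only [WaveCone.isSolution_pullback_iff hm, WaveCone.realWaveCone, Set.mem_iUnion,
    Set.mem_iInter, Set.mem_ofPred_eq]
  constructor
  · rintro ⟨π, hπ, h⟩
    obtain ⟨L, hL, rfl⟩ := WaveCone.exists_matrix_range_eq π hπ
    exact ⟨L, hL, fun y hy h0 => h y ⟨hy, h0⟩⟩
  · rintro ⟨L, hL, h⟩
    -- The subspace is the row space of L, of dimension n - r because Lᵀ is injective.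
    refine ⟨LinearMap.range (WaveCone.linMap Lᵀ).toLinearMap, ?_, fun y hy => h y hy.1 hy.2⟩
    rw [LinearMap.finrank_range_of_inj (WaveCone.linMap_transpose_injective hL)]
    simp
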